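/- Let $n\ge 1$. For a tuple $z=(z_1,\dots,z_n)$ of complex numbers, or of commuting operators, put $s_i(z)=\sum_{1\le k_1<\dots<k_i\le n} z_{k_1}\cdots z_{k_i}$ and $\mathbf s(z)=(s_1(z),\dots,s_n(z))$. Let $\Gamma_n=\mathbf s(\overline{\mathbb D}^n)\subset\mathbb C^n$, where $\overline{\mathbb D}$ is the closed unit disc, and let $b\Gamma_n$ be its distinguished boundary, that is, the Shilov boundary (smallest closed boundary) of the algebra of functions that are continuous on $\Gamma_n$ and analytic on the interior of $\Gamma_n$. A tuple $(S_1,\dots,S_n)$ of commuting bounded operators on a complex Hilbert space is called a $\Gamma_n$-unitary if every $S_i$ is normal and the joint spectrum $\sigma(S_1,\dots,S_n)$ is contained in $b\Gamma_n$. Here the joint spectrum is the set of $\mu\in\mathbb C^n$ for which at least one of the equations $\sum_i B_i(S_i-\mu_i I)=I$ and $\sum_i (S_i-\mu_i I)B_i=I$ has no solution in bounded operators $B_1,\dots,B_n$ (for commuting normal operators this agrees with the other usual notions, such as the Taylor spectrum and the spectrum of the generated unital commutative $C^*$-algebra). Let $\mathbf T=(T_1,\dots,T_n)$ be a tuple of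 commuting contractions on a complex Hilbert space $\mathcal H$. If the product $s_n(\mathbf T)=T_1\cdots T_n$ is unitary, then each $T_i$ is unitary and $\mathbf s(\mathbf T)$ is a $\Gamma_n$-unitary. -/

import Mathlib

/-- The elementary symmetric function of degree `i` of a tuple `z = (z_1, …, z_n)`: the sum of the
ordered products `z_{k_1} ⋯ z_{k_i}` over `k_1 < … < k_i`. It is applied to tuples of complex
numbers and to tuples of commuting operators. -/
def elemSymm {R : Type*} [Semiring R] {n : ℕ} (z : Fin n → R) (i : ℕ) : R :=
  ∑ t ∈ Finset.powersetCard i (Finset.univ : Finset (Fin n)), ((t.sort (· ≤ ·)).map z).prod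

/-- The symmetrization `s(z) = (s_1(z), …, s_n(z))`; the coordinate with (zero-based) index `i`
is `s_{i+1}(z)`. -/
def symmetrization {R : Type*} [Semiring R] {n : ℕ} (z : Fin n → R) : Fin n → R :=
  fun i => elemSymm z ((i : ℕ) + 1)

/-- The symmetrized `n`-disc `Γ_n`: the image under `s` of the closed unit polydisc. -/
def symmetrizedPolydisc (n : ℕ) : Set (Fin n → ℂ) :=
  symmetrization '' {z : Fin n → ℂ | ∀ i, ‖z i‖ ≤ 1}

/-- The functions that are continuous on `X ⊆ ℂⁿ` and analytic on the interior of `X`. -/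
def IsInDiscAlgebra {n : ℕ} (X : Set (Fin n → ℂ)) (f : (Fin n → ℂ) → ℂ) : Prop :=
  ContinuousOn f X ∧ AnalyticOnNhd ℂ f (interior X)

/-- `K` is a closed boundary for the algebra of functions that are continuous on `X` and analytic
on its interior: a closed subset of `X` on which every such function attains the maximum over `X`
of its modulus (for compact `X`). -/
def IsClosedBoundary {n : ℕ} (X K : Set (Fin n → ℂ)) : Prop :=
  K ⊆ X ∧ IsClosed K ∧
    ∀ f : (Fin n → ℂ) → ℂ, IsInDiscAlgebra X f → ∀ z ∈ X, ∃ w ∈ K, ‖f z‖ ≤ ‖f w‖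

/-- The Shilov boundary of the algebra of functions that are continuous on `X` and analytic on its
interior, i.e. the smallest closed boundary, obtained as the intersection of all of them. -/
def shilovBoundary {n : ℕ} (X : Set (Fin n → ℂ)) : Set (Fin n → ℂ) :=
  ⋂₀ {K | IsClosedBoundary X K}

/-- The distinguished boundary of `Γ_n`. -/
def distinguishedBoundary (n : ℕ) : Set (Fin n → ℂ) :=
  shilovBoundary (symmetrizedPolydisc n)

/-- The joint (Harte) spectrum of a tuple of bounded operators: `μ` lies outside it if and only if
both equations `∑ B_i (S_i - μ_i) = 1` and `∑ (S_i - μ_i) B_i = 1` are solvable by bounded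
operators. For `n = 1` this is the usual spectrum. For commuting normal operators it is the set of
points `(χ(S_1), …, χ(S_n))`, `χ` a character of the C*-algebra generated by `1, S_1, …, S_n`, and
it also coincides with the Taylor spectrum. -/
def jointSpectrum {H : Type*} [NormedAddCommGroup H] [InnerProductSpace ℂ H] {n : ℕ}
    (S : Fin n → H →L[ℂ] H) : Set (Fin n → ℂ) :=
  {μ | ¬ ((∃ B : Fin n → H →L[ℂ] H, ∑ i, B i * (S i - μ i • (1 : H →L[ℂ] H)) = 1) ∧
          (∃ B : Fin n → H →L[ℂ] H, ∑ i, (S i - μ i • (1 : H →L[ℂ] H)) * B i = 1))}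

/-- A `Γ_n`-unitary: a tuple of commuting normal operators whose joint spectrum is contained in the
distinguished boundary of `Γ_n`. -/
structure IsGammaUnitary {H : Type*} [NormedAddCommGroup H] [InnerProductSpace ℂ H]
    [CompleteSpace H] {n : ℕ} (S : Fin n → H →L[ℂ] H) : Prop where
  commute : ∀ i j, Commute (S i) (S j)
  normal : ∀ i, IsStarNormal (S i)
  jointSpectrum_subset : jointSpectrum S ⊆ distinguishedBoundary n

/-! If commuting contractions have a unitary product, every factor is isometric, since no norm can
be lost along the way, and invertible, hence unitary (`mem_unitary_of_list_prod_mem_unitary`).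

Commuting unitaries generate a commutative Banach algebra closed under adjoints. Its characters send
each `T i` to the unit circle, so by Gelfand theory every point of the joint spectrum of `s(T)` is
`s(a)` with `a` on the torus.

It remains to see that `s(a)` lies in every closed boundary `K` of `Γ_n`
(`IsClosedBoundary.symmetrization_mem`). A polynomial peaking at `a` is raised to a high power and
summed over permutations of the variables. The result is a polynomial in `s` which, if `s(a) ∉ K`,
is larger at `s(a)` than anywhere on `K`. Only this inclusion of `s` of the torus in the
distinguished boundary is needed. -/

/-! ### Elementary symmetric functions -/

lemma elemSymm_eq_sum_prod {R : Type*} [CommSemiring R] {n : ℕ} (z : Fin n → R) (i : ℕ) :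
    elemSymm z i = ∑ t ∈ Finset.powersetCard i (Finset.univ : Finset (Fin n)), ∏ k ∈ t, z k := by
  refine Finset.sum_congr rfl fun t _ => ?_
  rw [Finset.prod_eq_multiset_prod, ← Finset.sort_eq t (· ≤ ·), Multiset.map_coe,
    Multiset.prod_coe]

lemma map_elemSymm {R S F : Type*} [Semiring R] [Semiring S] [FunLike F R S] [RingHomClass F R S]
    (f : F) {n : ℕ} (z : Fin n → R) (i : ℕ) :
    f (elemSymm z i) = elemSymm (fun k => f (z k)) i := by
  simp only [elemSymm, map_sum, map_list_prod, List.map_map]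
  rfl

lemma aeval_esymm_eq_elemSymm {n : ℕ} (z : Fin n → ℂ) (i : ℕ) :
    MvPolynomial.aeval z (MvPolynomial.esymm (Fin n) ℂ i) = elemSymm z i := by
  simp [elemSymm_eq_sum_prod, MvPolynomial.esymm]

lemma symmetrization_comp_perm {n : ℕ} (z : Fin n → ℂ) (σ : Equiv.Perm (Fin n)) :
    symmetrization (z ∘ σ) = symmetrization z := by
  funext i
  simp only [symmetrization, ← aeval_esymm_eq_elemSymm]
  rw [← MvPolynomial.aeval_rename, MvPolynomial.esymm_isSymmetric]

lemma continuous_symmetrization (n : ℕ) :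
    Continuous (symmetrization : (Fin n → ℂ) → Fin n → ℂ) := by
  refine continuous_pi fun i => ?_
  simp only [symmetrization, elemSymm_eq_sum_prod]
  fun_prop

/-- Every symmetric polynomial is a polynomial in the components of the symmetrization. -/
lemma MvPolynomial.IsSymmetric.exists_aeval_symmetrization {n : ℕ}
    {p : MvPolynomial (Fin n) ℂ} (hp : p.IsSymmetric) :
    ∃ q : MvPolynomial (Fin n) ℂ, ∀ z : Fin n → ℂ,
      MvPolynomial.aeval (symmetrization z) q = MvPolynomial.aeval z p := by
  -- Fundamental theorem of symmetric polynomials.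
  obtain ⟨q, hq⟩ := MvPolynomial.esymmAlgHom_surjective (σ := Fin n) (R := ℂ) (n := n)
    (by simp) ⟨p, hp⟩
  refine ⟨q, fun z => ?_⟩
  have h : (MvPolynomial.esymmAlgHom (Fin n) ℂ n q : MvPolynomial (Fin n) ℂ) = p := by rw [hq]
  rw [← h]
  have : (MvPolynomial.aeval (symmetrization z) : MvPolynomial (Fin n) ℂ →ₐ[ℂ] ℂ) =
      ((MvPolynomial.aeval z).comp (MvPolynomial.symmetricSubalgebra (Fin n) ℂ).val).comp
        (MvPolynomial.esymmAlgHom (Fin n) ℂ n) := by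
    ext i
    simpa [MvPolynomial.esymmAlgHom, symmetrization, MvPolynomial.aeval_eq_eval] using
      (aeval_esymm_eq_elemSymm z (i + 1)).symm
  rw [this]
  rfl

/-! ### Peak polynomials and the distinguished boundary -/

lemma analyticOnNhd_aeval_mvPolynomial {n : ℕ} (q : MvPolynomial (Fin n) ℂ)
    (s : Set (Fin n → ℂ)) : AnalyticOnNhd ℂ (fun z => MvPolynomial.aeval z q) s := by
  refine AnalyticOnNhd.aeval_mvPolynomial (fun i => ?_) q
  exact (ContinuousLinearMap.proj (R := ℂ) (φ := fun _ : Fin n => ℂ) i).analyticOnNhd s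

lemma isInDiscAlgebra_aeval {n : ℕ} (q : MvPolynomial (Fin n) ℂ) (X : Set (Fin n → ℂ)) :
    IsInDiscAlgebra X (fun z => MvPolynomial.aeval z q) :=
  ⟨(analyticOnNhd_aeval_mvPolynomial q X).continuousOn, analyticOnNhd_aeval_mvPolynomial q _⟩

/-- The polynomial `∏ (1 + conj (a i) X i) / 2`, which peaks on the closed polydisc exactly at `a`
when `a` lies on the torus. -/
noncomputable def peakPolynomial {n : ℕ} (a : Fin n → ℂ) : MvPolynomial (Fin n) ℂ :=
  ∏ i, (MvPolynomial.C (1 / 2) *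
    (1 + MvPolynomial.C (starRingEnd ℂ (a i)) * MvPolynomial.X i))

lemma aeval_peakPolynomial {n : ℕ} (a z : Fin n → ℂ) :
    MvPolynomial.aeval z (peakPolynomial a) =
      ∏ i, ((1 / 2) * (1 + starRingEnd ℂ (a i) * z i)) := by
  simp [peakPolynomial]

lemma aeval_peakPolynomial_self {n : ℕ} {a : Fin n → ℂ} (ha : ∀ i, ‖a i‖ = 1) :
    MvPolynomial.aeval a (peakPolynomial a) = 1 := by
  rw [aeval_peakPolynomial]
  refine Finset.prod_eq_one fun i _ => ?_
  rw [mul_comm (starRingEnd ℂ (a i)), Complex.mul_conj, Complex.normSq_eq_norm_sq, ha]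
  norm_num

lemma norm_half_one_add_le {u : ℂ} (hu : ‖u‖ ≤ 1) : ‖(1 / 2) * (1 + u)‖ ≤ 1 := by
  rw [norm_mul]
  have := norm_add_le (1 : ℂ) u
  norm_num at this ⊢
  linarith

/-- In the closed disc `u ≠ 1` forces `Re u < 1`, and `|1 + u|² = 1 + 2 Re u + |u|²`. -/
lemma norm_half_one_add_lt {u : ℂ} (hu : ‖u‖ ≤ 1) (hne : u ≠ 1) : ‖(1 / 2) * (1 + u)‖ < 1 := by
  have h1 : Complex.normSq u ≤ 1 := by
    rw [Complex.normSq_eq_norm_sq]; exact pow_le_one₀ (norm_nonneg _) hu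
  have h2 : u.re < 1 := by
    refine lt_of_le_of_ne ((Complex.re_le_norm u).trans hu) fun h => hne ?_
    rw [Complex.normSq_apply, h] at h1
    exact Complex.ext h (by simpa using (by nlinarith : u.im = 0))
  have h3 : ‖(1 / 2) * (1 + u)‖ ^ 2 < 1 := by
    rw [← Complex.normSq_eq_norm_sq, map_mul, Complex.normSq_add]
    norm_num [Complex.normSq_ofNat] at h1 ⊢
    linarith
  exact (sq_lt_one_iff₀ (norm_nonneg _)).1 h3

lemma norm_aeval_peakPolynomial_lt {n : ℕ} {a z : Fin n → ℂ} (ha : ∀ i, ‖a i‖ = 1)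
    (hz : ∀ i, ‖z i‖ ≤ 1) (hne : z ≠ a) :
    ‖MvPolynomial.aeval z (peakPolynomial a)‖ < 1 := by
  obtain ⟨i, hi⟩ := Function.ne_iff.1 hne
  have hu : ∀ j, ‖starRingEnd ℂ (a j) * z j‖ ≤ 1 := fun j => by simpa [ha] using hz j
  rw [aeval_peakPolynomial, ← Finset.mul_prod_erase _ _ (Finset.mem_univ i), norm_mul]
  refine (mul_le_of_le_one_right (norm_nonneg _) ?_).trans_lt
    (norm_half_one_add_lt (hu i) fun h => hi ?_)
  · rw [norm_prod]
    exact Finset.prod_le_one (fun _ _ => norm_nonneg _) fun j _ => norm_half_one_add_le (hu j)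
  · have h1 : a i * starRingEnd ℂ (a i) = 1 := by
      rw [Complex.mul_conj, Complex.normSq_eq_norm_sq, ha]; norm_num
    calc z i = (a i * starRingEnd ℂ (a i)) * z i := by rw [h1, one_mul]
      _ = a i := by rw [mul_assoc, h, mul_one]

/-- The sum over all permutations of the variables of a polynomial. -/
noncomputable def symmetrizedSum {n : ℕ} (p : MvPolynomial (Fin n) ℂ) : MvPolynomial (Fin n) ℂ :=
  ∑ σ : Equiv.Perm (Fin n), MvPolynomial.rename σ p

lemma isSymmetric_symmetrizedSum {n : ℕ} (p : MvPolynomial (Fin n) ℂ) :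
    (symmetrizedSum p).IsSymmetric := by
  intro τ
  simp only [symmetrizedSum, map_sum, MvPolynomial.rename_rename]
  exact Fintype.sum_equiv (Equiv.mulLeft τ) _ _ fun σ => rfl

lemma aeval_symmetrizedSum {n : ℕ} (p : MvPolynomial (Fin n) ℂ) (z : Fin n → ℂ) :
    MvPolynomial.aeval z (symmetrizedSum p) =
      ∑ σ : Equiv.Perm (Fin n), MvPolynomial.aeval (z ∘ σ) p := by
  simp [symmetrizedSum, MvPolynomial.aeval_rename]

/-- Symmetrizations of points of the torus lie in every closed boundary of `Γ_n`. -/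
lemma IsClosedBoundary.symmetrization_mem {n : ℕ} {K : Set (Fin n → ℂ)}
    (hK : IsClosedBoundary (symmetrizedPolydisc n) K) {a : Fin n → ℂ} (ha : ∀ i, ‖a i‖ = 1) :
    symmetrization a ∈ K := by
  obtain ⟨hsub, hclosed, hmax⟩ := hK
  by_contra hnot
  set h : (Fin n → ℂ) → ℂ := fun z => MvPolynomial.aeval z (peakPolynomial a) with hh
  set L : Set (Fin n → ℂ) := Metric.closedBall 0 1 ∩ symmetrization ⁻¹' K
  have hLc : IsCompact L :=
    (isCompact_closedBall _ _).inter_right (hclosed.preimage (continuous_symmetrization n))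
  have hball : ∀ z : Fin n → ℂ, z ∈ Metric.closedBall (0 : Fin n → ℂ) 1 ↔ ∀ i, ‖z i‖ ≤ 1 :=
    fun z => by rw [mem_closedBall_zero_iff, pi_norm_le_iff_of_nonneg zero_le_one]
  have hcont : Continuous h := by
    simp only [hh, aeval_peakPolynomial]
    fun_prop
  -- The compact set `L` misses `a` because `s(a) ∉ K`, so the strict peak gives a uniform bound
  -- below 1 on it.
  obtain ⟨c, hc0, hc1, hc⟩ : ∃ c : ℝ, 0 ≤ c ∧ c < 1 ∧ ∀ z ∈ L, ‖h z‖ ≤ c := by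
    rcases L.eq_empty_or_nonempty with he | hne
    · exact ⟨0, le_rfl, one_pos, by simp [he]⟩
    · obtain ⟨z, hz, hzmax⟩ := hLc.exists_isMaxOn hne hcont.norm.continuousOn
      refine ⟨‖h z‖, norm_nonneg _, ?_, fun w hw => hzmax hw⟩
      refine norm_aeval_peakPolynomial_lt ha ((hball z).1 hz.1) ?_
      rintro rfl
      exact hnot hz.2
  -- Permutations moving `a` could cancel the peak value at `a`; high powers make their terms
  -- negligible.
  have hleft : Filter.Tendsto
      (fun N : ℕ => ∑ σ : Equiv.Perm (Fin n), if a ∘ σ = a then (0 : ℝ) else ‖h (a ∘ σ)‖ ^ N)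
      Filter.atTop (nhds 0) := by
    have key : ∀ σ : Equiv.Perm (Fin n), Filter.Tendsto
        (fun N : ℕ => if a ∘ σ = a then (0 : ℝ) else ‖h (a ∘ σ)‖ ^ N) Filter.atTop (nhds 0) := by
      intro σ
      by_cases hσ : a ∘ σ = a
      · simp only [if_pos hσ]
        exact tendsto_const_nhds
      · simp only [if_neg hσ]
        exact tendsto_pow_atTop_nhds_zero_of_lt_one (norm_nonneg _)
          (norm_aeval_peakPolynomial_lt ha (fun i => (ha _).le) hσ)
    have hsum := tendsto_finsetSum Finset.univ fun σ _ => key σ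
    rwa [Finset.sum_const_zero] at hsum
  have hright : Filter.Tendsto (fun N : ℕ => (Fintype.card (Equiv.Perm (Fin n)) : ℝ) * c ^ N)
      Filter.atTop (nhds 0) := by
    simpa using (tendsto_pow_atTop_nhds_zero_of_lt_one hc0 hc1).const_mul
      (Fintype.card (Equiv.Perm (Fin n)) : ℝ)
  -- With this `N` the symmetrized power has modulus below 1/2 on `K` and real part above 1 - 1/2 at
  -- `s(a)`.
  obtain ⟨N, hN1, hN2⟩ := ((hleft.eventually_lt_const (by norm_num : (0 : ℝ) < 1 / 2)).and
    (hright.eventually_lt_const (by norm_num : (0 : ℝ) < 1 / 2))).exists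
  obtain ⟨q, hq⟩ := (isSymmetric_symmetrizedSum
    (peakPolynomial a ^ N)).exists_aeval_symmetrization
  have hqs : ∀ z, MvPolynomial.aeval (symmetrization z) q =
      ∑ σ : Equiv.Perm (Fin n), h (z ∘ σ) ^ N := fun z => by
    rw [hq, aeval_symmetrizedSum]; simp only [map_pow, hh]
  obtain ⟨w, hwK, hw⟩ := hmax _ (isInDiscAlgebra_aeval q _) (symmetrization a)
    ⟨a, fun i => (ha i).le, rfl⟩
  obtain ⟨z, hz, rfl⟩ := hsub hwK
  simp only [hqs] at hw
  have hupper : ‖∑ σ : Equiv.Perm (Fin n), h (z ∘ σ) ^ N‖ < 1 / 2 := by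
    refine ((norm_sum_le _ _).trans ?_).trans_lt hN2
    rw [← nsmul_eq_mul, ← Finset.card_univ]
    refine Finset.sum_le_card_nsmul _ _ _ fun σ _ => ?_
    rw [norm_pow]
    refine pow_le_pow_left₀ (norm_nonneg _) (hc _ ⟨(hball _).2 fun i => hz _, ?_⟩) N
    change symmetrization (z ∘ σ) ∈ K
    rwa [symmetrization_comp_perm]
  have hlower : 1 / 2 < (∑ σ : Equiv.Perm (Fin n), h (a ∘ σ) ^ N).re := by
    -- Permutations fixing `a` contribute exactly 1 each; keeping only the identity among them
    -- suffices.
    have h1 : ∑ σ : Equiv.Perm (Fin n), (if σ = 1 then (1 : ℝ) else 0) ≤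
        ∑ σ : Equiv.Perm (Fin n), ((h (a ∘ σ) ^ N).re +
          if a ∘ σ = a then (0 : ℝ) else ‖h (a ∘ σ)‖ ^ N) := by
      refine Finset.sum_le_sum fun σ _ => ?_
      by_cases hσ : a ∘ σ = a
      · rw [if_pos hσ, hσ, hh]
        simp only [aeval_peakPolynomial_self ha, one_pow, Complex.one_re]
        split_ifs <;> norm_num
      · have hσ1 : σ ≠ 1 := by rintro rfl; exact hσ rfl
        rw [if_neg hσ, if_neg hσ1, ← norm_pow]
        have := (abs_le.1 (Complex.abs_re_le_norm (h (a ∘ σ) ^ N))).1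
        linarith
    rw [Finset.sum_add_distrib, Finset.sum_ite_eq' Finset.univ, if_pos (Finset.mem_univ _)] at h1
    rw [Complex.re_sum]
    linarith
  exact absurd (hlower.trans_le ((Complex.re_le_norm _).trans hw)) (not_lt.2 hupper.le)

lemma symmetrization_mem_distinguishedBoundary {n : ℕ} {a : Fin n → ℂ} (ha : ∀ i, ‖a i‖ = 1) :
    symmetrization a ∈ distinguishedBoundary n :=
  Set.mem_sInter.2 fun _ hK => IsClosedBoundary.symmetrization_mem hK ha

/-! ### Characters of commutative Banach algebras -/

/-- In a commutative complex Banach algebra, finitely many elements without a common zero on the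
characters generate the unit ideal. -/
lemma exists_sum_mul_eq_one_of_forall_algHom {A : Type*} [NormedRing A] [NormedAlgebra ℂ A]
    [CompleteSpace A] (hA : ∀ x y : A, x * y = y * x) {n : ℕ} (a : Fin n → A)
    (h : ∀ φ : A →ₐ[ℂ] ℂ, ∃ i, φ (a i) ≠ 0) :
    ∃ b : Fin n → A, ∑ i, b i * a i = 1 := by
  let : NormedCommRing A := { ‹NormedRing A› with mul_comm := hA }
  rw [← Ideal.mem_span_range_iff_exists_fun]
  by_contra hne
  -- By Gelfand–Mazur a maximal ideal is the kernel of a character, here a common zero of the `a i`.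
  obtain ⟨M, hM, haM⟩ := Ideal.exists_le_maximal _ ((Ideal.ne_top_iff_one _).2 hne)
  obtain ⟨i, hi⟩ := h (WeakDual.CharacterSpace.equivAlgHom M.toCharacterSpace)
  exact hi (M.toCharacterSpace_apply_eq_zero_of_mem
    (haM (Ideal.subset_span (Set.mem_range_self i))))

/-- Both `|φ u|` and `|φ v|` are at most 1 and their product is 1. Asking only `‖1‖ ≤ 1` admits the
zero algebra, which occurs for `H = 0`. -/
lemma norm_algHom_apply_eq_one {A : Type*} [NormedRing A] [NormedAlgebra ℂ A] [CompleteSpace A]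
    (h1 : ‖(1 : A)‖ ≤ 1) {u v : A} (hu : ‖u‖ ≤ 1) (hv : ‖v‖ ≤ 1) (huv : v * u = 1)
    (φ : A →ₐ[ℂ] ℂ) : ‖φ u‖ = 1 := by
  have hle : ∀ w : A, ‖w‖ ≤ 1 → ‖φ w‖ ≤ 1 := fun w hw =>
    (spectrum.norm_le_norm_mul_of_mem (AlgHom.apply_mem_spectrum φ w)).trans
      (mul_le_one₀ hw (norm_nonneg _) h1)
  have h3 : ‖φ v‖ * ‖φ u‖ = 1 := by rw [← norm_mul, ← map_mul, huv, map_one, norm_one]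
  nlinarith [norm_nonneg (φ u), norm_nonneg (φ v), hle u hu, hle v hv]

/-- In a commutative complex Banach algebra, the joint spectrum of the symmetrization of
contractions with contractive inverses lies in the distinguished boundary of `Γ_n`. -/
lemma exists_sum_mul_symmetrization_sub_eq_one {A : Type*} [NormedRing A] [NormedAlgebra ℂ A]
    [CompleteSpace A] (hA : ∀ x y : A, x * y = y * x) (h1 : ‖(1 : A)‖ ≤ 1) {n : ℕ}
    {U V : Fin n → A} (hU : ∀ i, ‖U i‖ ≤ 1) (hV : ∀ i, ‖V i‖ ≤ 1) (hVU : ∀ i, V i * U i = 1)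
    {μ : Fin n → ℂ} (hμ : μ ∉ distinguishedBoundary n) :
    ∃ b : Fin n → A, ∑ i, b i * (symmetrization U i - μ i • (1 : A)) = 1 := by
  refine exists_sum_mul_eq_one_of_forall_algHom hA _ fun φ => ?_
  by_contra! hφ
  refine hμ ?_
  have hμ' : μ = symmetrization fun k => φ (U k) := by
    funext i
    have := hφ i
    rw [map_sub, map_smul, map_one, smul_eq_mul, mul_one, sub_eq_zero] at this
    rw [← this]
    exact map_elemSymm φ U _
  rw [hμ']
  exact symmetrization_mem_distinguishedBoundary fun k =>
    norm_algHom_apply_eq_one h1 (hU k) (hV k) (hVU k) φ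

/-! ### Commuting contractions and unitaries on a Hilbert space -/

section Operators

variable {H : Type*} [NormedAddCommGroup H] [InnerProductSpace ℂ H] [CompleteSpace H]

/-- From `‖x‖ = ‖B A x‖ ≤ ‖A x‖ ≤ ‖x‖` the operator `A` is an isometry. It also has a right inverse,
which must then equal its adjoint. -/
lemma mem_unitary_left_of_mul_mem_unitary {A B : H →L[ℂ] H} (hAB : Commute A B) (hA : ‖A‖ ≤ 1)
    (hB : ‖B‖ ≤ 1) (h : A * B ∈ unitary (H →L[ℂ] H)) : A ∈ unitary (H →L[ℂ] H) := by
  have hiso : star A * A = 1 := by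
    refine A.norm_map_iff_adjoint_comp_self.1 fun x => le_antisymm ?_ ?_
    · simpa using A.le_of_opNorm_le hA x
    · calc ‖x‖ = ‖(A * B) x‖ := ((A * B).norm_map_iff_adjoint_comp_self.2
            (Unitary.star_mul_self_of_mem h) x).symm
        _ = ‖B (A x)‖ := by rw [hAB.eq]; rfl
        _ ≤ ‖A x‖ := by simpa using B.le_of_opNorm_le hB (A x)
  have hr : A * (B * star (A * B)) = 1 := by
    rw [← mul_assoc]; exact Unitary.mul_star_self_of_mem h
  have hs : star A = B * star (A * B) := left_inv_eq_right_inv hiso hr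
  exact Unitary.mem_iff.2 ⟨hiso, by rw [hs]; exact hr⟩

lemma norm_list_prod_le_one {l : List (H →L[ℂ] H)} (h : ∀ A ∈ l, ‖A‖ ≤ 1) : ‖l.prod‖ ≤ 1 := by
  induction l with
  | nil => exact ContinuousLinearMap.norm_id_le
  | cons A l ih =>
    rw [List.prod_cons]
    exact (norm_mul_le _ _).trans (mul_le_one₀ (h A (by simp)) (norm_nonneg _)
      (ih fun B hB => h B (by simp [hB])))

lemma mem_unitary_of_list_prod_mem_unitary {l : List (H →L[ℂ] H)}
    (hc : ∀ A ∈ l, ∀ B ∈ l, Commute A B) (hn : ∀ A ∈ l, ‖A‖ ≤ 1)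
    (h : l.prod ∈ unitary (H →L[ℂ] H)) : ∀ A ∈ l, A ∈ unitary (H →L[ℂ] H) := by
  induction l with
  | nil => simp
  | cons A l ih =>
    rw [List.prod_cons] at h
    have hA : ‖A‖ ≤ 1 := hn A (by simp)
    have hl : ‖l.prod‖ ≤ 1 := norm_list_prod_le_one fun B hB => hn B (by simp [hB])
    have hcomm : Commute A l.prod :=
      Commute.list_prod_right _ _ fun B hB => hc A (by simp) B (by simp [hB])
    -- The tail product is itself a contraction commuting with `A`, so the two-factor case applies
    -- with the roles exchanged.
    have hlu := mem_unitary_left_of_mul_mem_unitary hcomm.symm hl hA (hcomm.eq ▸ h)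
    intro B hB
    rcases List.mem_cons.1 hB with rfl | hB
    · exact mem_unitary_left_of_mul_mem_unitary hcomm hA hl h
    · exact ih (fun C hC D hD => hc C (by simp [hC]) D (by simp [hD]))
        (fun C hC => hn C (by simp [hC])) hlu B hB

/-- Commuting unitaries lie in a closed commutative star subalgebra. -/
lemma exists_commutative_starSubalgebra {ι : Type*} {T : ι → H →L[ℂ] H}
    (hcomm : ∀ i j, Commute (T i) (T j)) (hT : ∀ i, T i ∈ unitary (H →L[ℂ] H)) :
    ∃ S : StarSubalgebra ℂ (H →L[ℂ] H), IsClosed (S : Set (H →L[ℂ] H)) ∧ (∀ i, T i ∈ S) ∧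
      ∀ x y : S, x * y = y * x := by
  -- The adjoint of a unitary is its inverse, so it commutes with whatever commutes with the
  -- unitary.
  have hstar : ∀ i j, T i * star (T j) = star (T j) * T i := fun i j => by
    have h1 := Unitary.star_mul_self_of_mem (hT j)
    have h2 := Unitary.mul_star_self_of_mem (hT j)
    calc T i * star (T j) = star (T j) * T j * T i * star (T j) := by rw [h1, one_mul]
      _ = star (T j) * (T i * T j) * star (T j) := by rw [mul_assoc (star _), (hcomm j i).eq]
      _ = star (T j) * T i := by rw [← mul_assoc, mul_assoc _ (T j), h2, mul_one]
  have := StarAlgebra.isMulCommutative_adjoin ℂ (s := Set.range T)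
    (by rintro _ ⟨i, rfl⟩ _ ⟨j, rfl⟩; exact hcomm i j)
    (by rintro _ ⟨i, rfl⟩ _ ⟨j, rfl⟩; exact hstar i j)
  refine ⟨(StarAlgebra.adjoin ℂ (Set.range T)).topologicalClosure, isClosed_closure,
    fun i => StarSubalgebra.le_topologicalClosure _
      (StarAlgebra.subset_adjoin ℂ _ (Set.mem_range_self i)), ?_⟩
  exact (StarSubalgebra.commRingTopologicalClosure _
    (fun x y => this.is_comm.comm x y)).mul_comm

/-- The symmetrization of commuting unitary contractions is a `Γ_n`-unitary. -/
lemma isGammaUnitary_symmetrization {n : ℕ} {T : Fin n → H →L[ℂ] H}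
    (hcomm : ∀ i j, Commute (T i) (T j)) (hcontr : ∀ i, ‖T i‖ ≤ 1)
    (hT : ∀ i, T i ∈ unitary (H →L[ℂ] H)) : IsGammaUnitary (symmetrization T) := by
  obtain ⟨S, hclosed, hmem, hS⟩ := exists_commutative_starSubalgebra hcomm hT
  have : CompleteSpace S := hclosed.completeSpace_coe
  let U : Fin n → S := fun i => ⟨T i, hmem i⟩
  have hU : ∀ i, symmetrization T i = ((symmetrization U i : S) : H →L[ℂ] H) := fun i =>
    (map_elemSymm S.subtype U _).symm
  refine ⟨fun i j => ?_, fun i => ⟨?_⟩, fun μ hμ => ?_⟩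
  · rw [hU, hU]
    exact congrArg Subtype.val (hS _ _)
  · rw [hU]
    exact congrArg Subtype.val (hS (star (symmetrization U i)) _)
  · by_contra hnot
    refine hμ ?_
    obtain ⟨b, hb⟩ := exists_sum_mul_symmetrization_sub_eq_one hS
      (ContinuousLinearMap.norm_id_le : ‖(1 : H →L[ℂ] H)‖ ≤ 1) (U := U) (V := fun i => star (U i))
      hcontr (fun i => (norm_star (T i)).trans_le (hcontr i))
      (fun i => Subtype.ext (Unitary.star_mul_self_of_mem (hT i))) hnot
    -- Commutativity of `S` lets the same `b` solve both the left and the right equation.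
    have hb' : ∑ i, (symmetrization U i - μ i • (1 : S)) * b i = 1 :=
      (Finset.sum_congr rfl fun i _ => hS _ _).trans hb
    refine ⟨⟨fun i => b i, ?_⟩, ⟨fun i => b i, ?_⟩⟩
    · simpa [hU] using congrArg S.subtype hb
    · simpa [hU] using congrArg S.subtype hb'

end Operators

theorem mainTheorem12 {H : Type*} [NormedAddCommGroup H] [InnerProductSpace ℂ H]
    [CompleteSpace H] {n : ℕ} (T : Fin n → H →L[ℂ] H)
    (hcomm : ∀ i j, Commute (T i) (T j)) (hcontr : ∀ i, ‖T i‖ ≤ 1)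
    (hprod : (List.ofFn T).prod ∈ unitary (H →L[ℂ] H)) :
    (∀ i, T i ∈ unitary (H →L[ℂ] H)) ∧ IsGammaUnitary (symmetrization T) := by
  have hT : ∀ i, T i ∈ unitary (H →L[ℂ] H) := by
    have := mem_unitary_of_list_prod_mem_unitary (l := List.ofFn T)
      (by simpa [List.mem_ofFn] using hcomm)
      (by simpa [List.mem_ofFn] using hcontr) hprod
    exact fun i => this _ (List.mem_ofFn.2 ⟨i, rfl⟩)
  exact ⟨hT, isGammaUnitary_symmetrization hcomm hcontr hT⟩
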